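/- Let $(R,\mathfrak m)$ be a complete discrete valuation ring with finite residue field $R/\mathfrak m=\mathbb F_q$, and let $P_1(t),\dots,P_r(t)\in R[t]$ (with $r\ge 0$) be monic polynomials whose reductions modulo $\mathfrak m$ are pairwise distinct irreducible polynomials in $\mathbb F_q[t]$. For $n\ge 0$ let $\operatorname{Prob}_{A\in \mathrm{Mat}_n(R)}$ denote the Haar measure of total mass $1$ on the compact additive group $\mathrm{Mat}_n(R)$ of $n\times n$ matrices over $R$ (with the $\mathfrak m$-adic topology), and for $M\in\mathrm{Mat}_n(R)$ let $\operatorname{coker}(M)=R^n/MR^n$. Then the infinite products below converge, and $$\lim_{n\to\infty}\operatorname{Prob}_{A\in \mathrm{Mat}_n(R)}\bigl(\operatorname{coker}(P_j(A))=0\text{ for } 1\le j\le r\bigr)=\prod_{j=1}^{r}\prod_{i=1}^{\infty}\bigl(1-q^{-i\deg(P_j)}\bigr).$$ Consequently the events $\operatorname{coker}(P_j(A))=0$ are asymptotically independent: for every $S\subseteq\{1,\dots,r\}$, $$\lim_{n\to\infty}\Bigl[\operatorname{Prob}_{A\in \mathrm{Mat}_n(R)}\bigl(\operatorname{coker}(P_j(A))=0\text{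 for all } j\in S\bigr)-\prod_{j\in S}\operatorname{Prob}_{A\in \mathrm{Mat}_n(R)}\bigl(\operatorname{coker}(P_j(A))=0\bigr)\Bigr]=0.$$ -/

import Mathlib

open Filter Topology MeasureTheory Polynomial
open IsLocalRing (maximalIdeal ResidueField residue)

namespace HaarMatrix

/-- A local ring that is complete for its finitely generated maximal ideal `𝔪`, with finite
residue field, is compact in the `𝔪`-adic topology. (Needed to normalise the Haar measure.) -/
theorem compactSpace_adic (R : Type*) [CommRing R] [IsLocalRing R] [IsNoetherianRing R]
    [IsAdicComplete (maximalIdeal R) R] [Finite (ResidueField R)] :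
    @CompactSpace R (maximalIdeal R).adicTopology := by
  let : TopologicalSpace R := (maximalIdeal R).adicTopology
  refine ⟨isCompact_iff_ultrafilter_le_nhds.2 fun f _ => ?_⟩
  have key : ∀ k : ℕ, ∃ x : R, ∀ᶠ y in (f : Filter R), x - y ∈ maximalIdeal R ^ k := by
    intro k
    have : Finite (R ⧸ maximalIdeal R) := ‹Finite (ResidueField R)›
    have : Finite (R ⧸ maximalIdeal R ^ k) :=
      Ideal.finite_quotient_pow (IsNoetherian.noetherian _) k
    have h : ∀ᶠ y in (f : Filter R),
        ∃ c : R ⧸ maximalIdeal R ^ k, c = Ideal.Quotient.mk _ y :=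
      Eventually.of_forall fun y => ⟨_, rfl⟩
    obtain ⟨c, hc⟩ := Ultrafilter.eventually_exists_iff.1 h
    obtain ⟨x, rfl⟩ := Ideal.Quotient.mk_surjective c
    exact ⟨x, hc.mono fun y hy => Ideal.Quotient.eq.1 hy⟩
  choose x hx using key
  obtain ⟨L, hL⟩ := IsPrecomplete.prec' (I := maximalIdeal R) (M := R) x (by
    intro m n hmn
    obtain ⟨y, hy1, hy2⟩ := ((hx m).and (hx n)).exists
    rw [SModEq.sub_mem, smul_eq_mul, Ideal.mul_top]
    have := Ideal.sub_mem _ hy1 (Ideal.pow_le_pow_right hmn hy2)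
    simpa using this)
  refine ⟨L, Set.mem_univ _, ?_⟩
  rw [((maximalIdeal R).hasBasis_nhds_adic L).ge_iff]
  intro k _
  filter_upwards [hx k] with y hy
  have h := hL k
  rw [SModEq.sub_mem, smul_eq_mul, Ideal.mul_top] at h
  refine ⟨y - L, ?_, by simp⟩
  have := Ideal.sub_mem _ h hy
  simpa using this

section Haar

variable (R : Type*) [CommRing R] [IsDomain R] [IsDiscreteValuationRing R] (n : ℕ)

/-- The topology on `Mat_n(R)`: the product of the `𝔪`-adic topologies on the entries. -/
@[reducible] def matrixTopology : TopologicalSpace (Matrix (Fin n) (Fin n) R) :=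
  letI : TopologicalSpace R := (maximalIdeal R).adicTopology
  inferInstance

theorem matrix_isTopologicalAddGroup :
    @IsTopologicalAddGroup (Matrix (Fin n) (Fin n) R) (matrixTopology R n) _ := by
  let : TopologicalSpace R := (maximalIdeal R).adicTopology
  have : NonarchimedeanRing R := (maximalIdeal R).nonarchimedean
  infer_instance

theorem matrix_compactSpace [IsAdicComplete (maximalIdeal R) R] [Finite (ResidueField R)] :
    @CompactSpace (Matrix (Fin n) (Fin n) R) (matrixTopology R n) := by
  let : TopologicalSpace R := (maximalIdeal R).adicTopology
  have : CompactSpace R := compactSpace_adic R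
  exact inferInstanceAs (CompactSpace (Fin n → Fin n → R))

/-- The Borel `σ`-algebra of `Mat_n(R)`. -/
@[reducible] def matrixBorel : MeasurableSpace (Matrix (Fin n) (Fin n) R) :=
  @borel _ (matrixTopology R n)

/-- The Haar measure of the compact additive group `Mat_n(R)`, normalised to total mass `1`. -/
noncomputable def matrixHaar [IsAdicComplete (maximalIdeal R) R] [Finite (ResidueField R)] :
    @Measure (Matrix (Fin n) (Fin n) R) (matrixBorel R n) :=
  letI := matrixTopology R n
  letI := matrixBorel R n
  haveI : BorelSpace (Matrix (Fin n) (Fin n) R) := ⟨rfl⟩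
  haveI := matrix_isTopologicalAddGroup R n
  haveI := matrix_compactSpace R n
  Measure.addHaarMeasure (⊤ : TopologicalSpace.PositiveCompacts (Matrix (Fin n) (Fin n) R))

/-- `Prob_{A ∈ Mat_n(R)} (A ∈ E)` for the Haar probability measure on `Mat_n(R)`. -/
noncomputable def haarProb [IsAdicComplete (maximalIdeal R) R] [Finite (ResidueField R)]
    (E : Set (Matrix (Fin n) (Fin n) R)) : ℝ :=
  letI := matrixBorel R n
  (matrixHaar R n).real E

end Haar

/-- The cokernel of `M : R^n → R^n`, as an `R`-module. -/
abbrev coker {R : Type*} [CommRing R] {n : ℕ} (M : Matrix (Fin n) (Fin n) R) : Type _ :=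
  (Fin n → R) ⧸ LinearMap.range M.mulVecLin

/-- The event that `coker (P(A)) = 0`. -/
def cokerVanishes {R : Type*} [CommRing R] (P : R[X]) (n : ℕ) :
    Set (Matrix (Fin n) (Fin n) R) :=
  {A | Subsingleton (coker (aeval A P))}

end HaarMatrix

/-!
The event `coker (P_j(A)) = 0` depends only on the reduction of `A` modulo `𝔪`: by Nakayama, or
determinants, it says that `P_j(A)` is invertible over `F = 𝔽_q` (`mem_cokerVanishes_iff`), and the
Haar measure reduces to the uniform measure on `Mat_n(F)` (`haarProb_preimage_residue`). So one has
to find the proportion of the endomorphisms `a` of `V = F^n` for which all `P_j(a)` are invertible.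

This is done by moments. Let `κ_j = F[X] / P_j`, a field with `Q_j = q ^ deg P_j` elements, and let
`k_j` be the dimension over `κ_j` of the kernel of `P_j(a)`. The finite `q`-binomial theorem
(`sum_eulerCoeff_mul`) writes the indicator of `k_j = 0` as
`∑_m c_j(m) ∏_{i < m} (Q_j ^ k_j - Q_j ^ i)` with `c_j(m) = (-1)^m / ∏_{i=1}^m (Q_j ^ i - 1)`. The
product `∏_{i < m} (Q_j ^ k_j - Q_j ^ i)` counts the embeddings of `F[X]`-modules of `κ_j ^ m` into
`V`, with `X` acting through `a`. As the `P_j` are pairwise coprime, the product of these counts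
over `j` is the number of embeddings of `M = ⨁ κ_j ^ m_j` (`card_injective_pi`). Its average over
`a` is simply the proportion of the injective maps among all `F`-linear maps `M → V`
(`sum_card_injective`), that is `∏_{i < D} (1 - q ^ (i - n))` with `D = dim M`.

As `n → ∞` these averages are bounded by `1` and tend to `1`, and the `c_j` are absolutely
summable. Dominated convergence (`tendsto_sum_mul_injProportion`) gives the limit
`∏_j ∑_m c_j(m)`, which Euler's identity (`tsum_eulerCoeff`) turns into the infinite products.
Applied to a subfamily and to its single members, this yields asymptotic independence.
-/

/-! ### The `q`-binomial theorem -/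

/-- The coefficients `(-1)^m / ∏_{i=1}^m (Q^i - 1)` of Euler's expansion of
`∏_{i ≥ 1} (1 - Q^{-i})`. -/
noncomputable def eulerCoeff (Q : ℝ) (m : ℕ) : ℝ :=
  ∏ i ∈ Finset.range m, -(Q ^ (i + 1) - 1)⁻¹

lemma eulerCoeff_succ (Q : ℝ) (m : ℕ) :
    eulerCoeff Q (m + 1) = eulerCoeff Q m * -(Q ^ (m + 1) - 1)⁻¹ :=
  Finset.prod_range_succ _ _

/-- The finite `q`-binomial theorem, with the Gaussian binomial coefficients written through
the numbers `∏_{i < m} (Q^k - Q^i)` of linearly independent `m`-tuples in a `k`-dimensional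
space over a field with `Q` elements. The terms with `m > k` vanish. -/
lemma sum_eulerCoeff_mul {Q : ℝ} (hQ : 1 < Q) (x : ℝ) {k N : ℕ} (h : k ≤ N) :
    ∑ m ∈ Finset.range (N + 1),
      eulerCoeff Q m * (∏ i ∈ Finset.range m, (Q ^ k - Q ^ i)) * x ^ m =
      ∏ i ∈ Finset.range k, (1 - x * Q ^ i) := by
  induction k generalizing N with
  | zero =>
    rw [Finset.sum_range_succ', Finset.sum_eq_zero]
    · simp [eulerCoeff]
    · intro m _
      rw [Finset.prod_eq_zero (Finset.mem_range.2 m.succ_pos) (by simp)]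
      simp
  | succ k ih =>
    obtain ⟨N, rfl⟩ : ∃ M, N = M + 1 := ⟨N - 1, by omega⟩
    have hk : k ≤ N := by omega
    have key : ∀ m, eulerCoeff Q (m + 1) *
        (∏ i ∈ Finset.range (m + 1), (Q ^ (k + 1) - Q ^ i)) * x ^ (m + 1) =
        eulerCoeff Q (m + 1) * (∏ i ∈ Finset.range (m + 1), (Q ^ k - Q ^ i)) * x ^ (m + 1) -
        x * Q ^ k * (eulerCoeff Q m * (∏ i ∈ Finset.range m, (Q ^ k - Q ^ i)) * x ^ m) := by
      intro m
      have h1 : ∏ i ∈ Finset.range (m + 1), (Q ^ (k + 1) - Q ^ i) =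
          (Q ^ (k + 1) - 1) * (Q ^ m * ∏ i ∈ Finset.range m, (Q ^ k - Q ^ i)) := by
        rw [Finset.prod_range_succ', mul_comm, pow_zero]
        congr 1
        rw [Finset.prod_congr rfl (g := fun i => Q * (Q ^ k - Q ^ i)) (fun i _ => by ring),
          Finset.prod_mul_distrib]
        simp
      have h2 : Q ^ (m + 1) - 1 ≠ 0 := (sub_pos.2 (one_lt_pow₀ hQ m.succ_ne_zero)).ne'
      rw [h1, Finset.prod_range_succ, eulerCoeff_succ]
      field_simp
      ring
    rw [Finset.prod_range_succ, ← ih hk, Finset.sum_range_succ', Finset.sum_congr rfl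
      (fun m _ => key m), Finset.sum_sub_distrib, ← Finset.mul_sum, ih hk]
    have h3 := ih (N := N + 1) (by omega)
    rw [Finset.sum_range_succ'] at h3
    simp only [Finset.range_zero, Finset.prod_empty, pow_zero] at h3 ⊢
    linear_combination h3

lemma sum_eulerCoeff_mul_eq_ite {Q : ℝ} (hQ : 1 < Q) {k N : ℕ} (h : k ≤ N) :
    ∑ m ∈ Finset.range (N + 1),
      eulerCoeff Q m * (∏ i ∈ Finset.range m, (Q ^ k - Q ^ i)) = if k = 0 then 1 else 0 := by
  have := sum_eulerCoeff_mul hQ 1 h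
  simp only [one_pow, mul_one, one_mul] at this
  rw [this]
  split_ifs with hk
  · simp [hk]
  · exact Finset.prod_eq_zero (Finset.mem_range.2 (Nat.pos_of_ne_zero hk)) (by simp)

lemma summable_abs_eulerCoeff {Q : ℝ} (hQ : 1 < Q) : Summable fun m => |eulerCoeff Q m| := by
  refine Summable.abs (summable_of_ratio_norm_eventually_le (r := 1 / 2) (by norm_num) ?_)
  filter_upwards [(tendsto_pow_atTop_atTop_of_one_lt hQ).eventually_ge_atTop 3] with m hm
  have h1 : 3 ≤ Q ^ (m + 1) := hm.trans (pow_le_pow_right₀ hQ.le m.le_succ)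
  rw [eulerCoeff_succ, norm_mul, mul_comm]
  gcongr
  rw [norm_neg, norm_inv, one_div, Real.norm_of_nonneg (by linarith)]
  exact inv_anti₀ (by norm_num) (by linarith)

/-! ### Series over multi-indices and dominated convergence -/

lemma tendsto_piFinset_range {ι : Type*} [Fintype ι] [DecidableEq ι] :
    Tendsto (fun n : ℕ => Fintype.piFinset fun _ : ι => Finset.range (n + 1)) atTop atTop := by
  refine tendsto_atTop_finset_of_monotone (fun a b hab => ?_) fun m => ?_
  · exact Fintype.piFinset_subset _ _ fun _ => Finset.range_mono (by omega)
  · refine ⟨∑ j, m j, Fintype.mem_piFinset.2 fun j => Finset.mem_range.2 ?_⟩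
    exact Nat.lt_succ_of_le (Finset.single_le_sum (fun _ _ => Nat.zero_le _) (Finset.mem_univ j))

/-- The product of finitely many absolutely convergent series, as a series over multi-indices. -/
lemma hasSum_prod_of_summable_abs {ι : Type*} [Fintype ι] (c : ι → ℕ → ℝ)
    (hc : ∀ j, Summable fun m => |c j m|) :
    (Summable fun m : ι → ℕ => ∏ j, |c j (m j)|) ∧
      HasSum (fun m : ι → ℕ => ∏ j, c j (m j)) (∏ j, ∑' m, c j m) := by
  classical
  have h1 : Summable fun m : ι → ℕ => ∏ j, |c j (m j)| := by
    refine summable_of_sum_le (c := ∏ j, ∑' m, |c j m|)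
      (fun m => Finset.prod_nonneg fun _ _ => abs_nonneg _) fun s => ?_
    obtain ⟨n, hn⟩ := (tendsto_piFinset_range.eventually_ge_atTop s).exists
    refine (Finset.sum_le_sum_of_subset_of_nonneg hn fun m _ _ =>
      Finset.prod_nonneg fun _ _ => abs_nonneg _).trans ?_
    rw [← Finset.prod_univ_sum (fun _ : ι => Finset.range (n + 1)) fun j m => |c j m|]
    exact Finset.prod_le_prod (fun _ _ => Finset.sum_nonneg fun _ _ => abs_nonneg _)
      fun j _ => (hc j).sum_le_tsum _ fun _ _ => abs_nonneg _
  refine ⟨h1, ?_⟩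
  have h2 : Summable fun m : ι → ℕ => ∏ j, c j (m j) := by
    refine Summable.of_abs ?_
    simpa only [Finset.abs_prod] using h1
  have h3 := h2.hasSum.comp tendsto_piFinset_range
  have h4 : Tendsto (fun n : ℕ => ∏ j, ∑ m ∈ Finset.range (n + 1), c j m) atTop
      (𝓝 (∏ j, ∑' m, c j m)) :=
    tendsto_finsetProd _ fun j _ =>
      (hc j).of_abs.hasSum.tendsto_sum_nat.comp (tendsto_add_atTop_nat 1)
  have h5 : (fun n : ℕ => ∏ j, ∑ m ∈ Finset.range (n + 1), c j m) =
      fun n => ∑ m ∈ Fintype.piFinset fun _ : ι => Finset.range (n + 1), ∏ j, c j (m j) :=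
    funext fun n => Finset.prod_univ_sum _ _
  rw [h5] at h4
  exact tendsto_nhds_unique h3 h4 ▸ h2.hasSum

/-- The proportion `∏_{i < D} (q^n - q^i) / q^n` of injective maps among all linear maps from a
`D`-dimensional to an `n`-dimensional space over a field with `q` elements. -/
noncomputable def injProportion (q : ℝ) (n D : ℕ) : ℝ :=
  ∏ i ∈ Finset.range D, ((q ^ n - q ^ i) / q ^ n)

lemma injProportion_eq_zero {q : ℝ} {n D : ℕ} (h : n < D) : injProportion q n D = 0 :=
  Finset.prod_eq_zero (Finset.mem_range.2 h) (by simp)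

lemma abs_injProportion_le_one {q : ℝ} (hq : 1 < q) (n D : ℕ) : |injProportion q n D| ≤ 1 := by
  rcases lt_or_ge n D with h | h
  · simp [injProportion_eq_zero h]
  rw [injProportion, Finset.abs_prod]
  refine Finset.prod_le_one (fun _ _ => abs_nonneg _) fun i hi => ?_
  have h0 : 0 < q ^ n := by positivity
  have h1 : q ^ i ≤ q ^ n := pow_le_pow_right₀ hq.le ((Finset.mem_range.1 hi).le.trans h)
  have h2 : 0 < q ^ i := by positivity
  rw [abs_of_nonneg (div_nonneg (by linarith) h0.le), div_le_one h0]
  linarith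

lemma tendsto_injProportion {q : ℝ} (hq : 1 < q) (D : ℕ) :
    Tendsto (fun n => injProportion q n D) atTop (𝓝 1) := by
  have : ∀ i ∈ Finset.range D, Tendsto (fun n : ℕ => (q ^ n - q ^ i) / q ^ n) atTop (𝓝 1) := by
    intro i _
    have h := ((tendsto_pow_atTop_atTop_of_one_lt hq).inv_tendsto_atTop.const_mul
      (q ^ i)).const_sub 1
    rw [mul_zero, sub_zero] at h
    refine h.congr fun n => ?_
    have h0 : q ^ n ≠ 0 := by positivity
    simp only [Pi.inv_apply]
    field_simp
  simpa [injProportion] using tendsto_finsetProd _ this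

/-- Passage to the limit under the sum over multi-indices, by dominated convergence. -/
lemma tendsto_sum_mul_injProportion {ι : Type*} [Fintype ι] [DecidableEq ι] (c : ι → ℕ → ℝ)
    (hc : ∀ j, Summable fun m => |c j m|) {q : ℝ} (hq : 1 < q) (d : ι → ℕ) (hd : ∀ j, 0 < d j) :
    Tendsto (fun n : ℕ => ∑ m ∈ Fintype.piFinset fun _ : ι => Finset.range (n + 1),
        (∏ j, c j (m j)) * injProportion q n (∑ j, m j * d j)) atTop
      (𝓝 (∏ j, ∑' m, c j m)) := by
  obtain ⟨h1, h2⟩ := hasSum_prod_of_summable_abs c hc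
  rw [← h2.tsum_eq]
  have h3 : ∀ n : ℕ, ∑ m ∈ Fintype.piFinset fun _ : ι => Finset.range (n + 1),
      (∏ j, c j (m j)) * injProportion q n (∑ j, m j * d j) =
      ∑' m : ι → ℕ, (∏ j, c j (m j)) * injProportion q n (∑ j, m j * d j) := by
    intro n
    refine (tsum_eq_sum fun m hm => ?_).symm
    simp only [Fintype.mem_piFinset, Finset.mem_range, not_forall, not_lt] at hm
    obtain ⟨j, hj⟩ := hm
    rw [injProportion_eq_zero, mul_zero]
    calc n < m j := hj
      _ ≤ m j * d j := Nat.le_mul_of_pos_right _ (hd j)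
      _ ≤ _ := Finset.single_le_sum (f := fun j => m j * d j) (fun _ _ => Nat.zero_le _)
        (Finset.mem_univ j)
  simp_rw [h3]
  refine tendsto_tsum_of_dominated_convergence h1 (fun m => ?_) (Eventually.of_forall fun n m => ?_)
  · simpa using (tendsto_injProportion hq (∑ j, m j * d j)).const_mul (∏ j, c j (m j))
  · rw [norm_mul, Real.norm_eq_abs, Real.norm_eq_abs, Finset.abs_prod]
    exact mul_le_of_le_one_right (Finset.prod_nonneg fun _ _ => abs_nonneg _)
      (abs_injProportion_le_one hq _ _)

lemma multipliable_one_sub_inv_pow {Q : ℝ} (hQ : 1 < Q) :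
    Multipliable fun i : ℕ => 1 - (Q ^ (i + 1))⁻¹ := by
  have h : Summable fun i : ℕ => ‖-(Q ^ (i + 1))⁻¹‖ := by
    have := (summable_nat_add_iff 1).2
      (summable_geometric_of_lt_one (by positivity) (inv_lt_one_of_one_lt₀ hQ))
    refine this.congr fun i => ?_
    rw [norm_neg, norm_inv, norm_pow, Real.norm_of_nonneg (by positivity), inv_pow]
  simpa only [sub_eq_add_neg] using multipliable_one_add_of_summable h

/-- Euler's expansion of `∏_{i ≥ 1} (1 - Q^{-i})`. -/
lemma tsum_eulerCoeff {Q : ℝ} (hQ : 1 < Q) :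
    ∑' m, eulerCoeff Q m = ∏' i : ℕ, (1 - (Q ^ (i + 1))⁻¹) := by
  have h1 := tendsto_sum_mul_injProportion (ι := Unit) (fun _ => eulerCoeff Q)
    (fun _ => summable_abs_eulerCoeff hQ) hQ (fun _ => 1) fun _ => one_pos
  have h2 := (multipliable_one_sub_inv_pow hQ).hasProd.tendsto_prod_nat
  simp only [Finset.univ_unique, Finset.prod_singleton, Finset.sum_singleton, mul_one] at h1
  refine tendsto_nhds_unique h1 (h2.congr fun n => ?_)
  -- the `q`-binomial theorem at `x = Q⁻ⁿ`
  have h3 := sum_eulerCoeff_mul hQ (Q ^ n)⁻¹ le_rfl (k := n)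
  rw [← Finset.prod_range_reflect] at h3
  rw [Finset.prod_congr rfl (g := fun i => 1 - (Q ^ n)⁻¹ * Q ^ (n - 1 - i)), ← h3]
  · refine Finset.sum_nbij' (fun m _ => m) (fun m => m ()) (fun m hm => by simpa using hm)
      (fun m hm => by simpa using Fintype.mem_piFinset.1 hm ()) (fun _ _ => rfl)
      (fun _ _ => rfl) fun m _ => ?_
    rw [injProportion, Finset.prod_div_distrib, Finset.prod_const, Finset.card_range,
      inv_pow, div_eq_mul_inv]
    exact mul_assoc _ _ _
  · intro i hi
    have hi' : (i + 1) + (n - 1 - i) = n := by have := Finset.mem_range.1 hi; omega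
    have h0 : Q ^ (n - 1 - i) ≠ 0 := by positivity
    have h4 := pow_add Q (i + 1) (n - 1 - i)
    rw [hi'] at h4
    rw [h4, mul_inv, mul_assoc, inv_mul_cancel₀ h0, mul_one]

/-! ### Counting embeddings of modules -/

lemma card_linearIndependent_fin (K V : Type*) [Field K] [Finite K] [AddCommGroup V] [Module K V]
    [Finite V] (m : ℕ) :
    (Nat.card {s : Fin m → V // LinearIndependent K s} : ℝ) =
      ∏ i ∈ Finset.range m, ((Nat.card K : ℝ) ^ Module.finrank K V - (Nat.card K : ℝ) ^ i) := by
  have := Fintype.ofFinite K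
  rcases le_or_gt m (Module.finrank K V) with h | h
  · rw [card_linearIndependent h, Nat.cast_prod, ← Fin.prod_univ_eq_prod_range
      (fun i => (Nat.card K : ℝ) ^ Module.finrank K V - (Nat.card K : ℝ) ^ i)]
    refine Finset.prod_congr rfl fun i _ => ?_
    rw [Nat.card_eq_fintype_card, Nat.cast_sub, Nat.cast_pow, Nat.cast_pow]
    exact Nat.pow_le_pow_right Fintype.card_pos (i.2.le.trans h)
  · rw [Finset.prod_eq_zero (Finset.mem_range.2 h) (sub_self _)]
    have : IsEmpty {s : Fin m → V // LinearIndependent K s} :=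
      ⟨fun s => by simpa using s.2.fintype_card_le_finrank.trans_lt h⟩
    simp

/-- Linear maps over `R` between `K`-spaces are `K`-linear when `R → K` is surjective, so the
embeddings of `K ^ m` correspond to the linearly independent `m`-tuples. -/
lemma card_injective_fin (R K V : Type*) [CommRing R] [Field K] [Finite K] [Algebra R K]
    (hK : Function.Surjective (algebraMap R K)) [AddCommGroup V] [Module R V] [Module K V]
    [IsScalarTower R K V] [Finite V] (m : ℕ) :
    (Nat.card {φ : (Fin m → K) →ₗ[R] V // Function.Injective φ} : ℝ) =
      ∏ i ∈ Finset.range m, ((Nat.card K : ℝ) ^ Module.finrank K V - (Nat.card K : ℝ) ^ i) := by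
  rw [← card_linearIndependent_fin]
  congr 1
  refine Nat.card_congr (Equiv.subtypeEquiv
    ((LinearMap.extendScalarsOfSurjectiveEquiv hK).toEquiv.trans
      (LinearEquiv.piRing K V (Fin m) K).toEquiv) fun φ => ?_)
  rw [linearIndependent_iff_injective_fintypeLinearCombination]
  have : ⇑(Fintype.linearCombination K
      ((LinearEquiv.piRing K V (Fin m) K) (LinearMap.extendScalarsOfSurjective hK φ))) = φ := by
    have h := (LinearEquiv.piRing K V (Fin m) K).symm_apply_apply
      (LinearMap.extendScalarsOfSurjective hK φ)
    funext x
    have h' := LinearMap.congr_fun h x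
    rw [LinearEquiv.piRing_symm_apply] at h'
    exact h'
  exact (congrArg Function.Injective this).to_iff.symm

/-- The injective homomorphisms out of a finite direct sum of modules that are killed by pairwise
coprime elements are the families of injective homomorphisms out of the summands. -/
def injectiveLsumEquiv {R ι W : Type*} [CommRing R] [Fintype ι] [DecidableEq ι] [AddCommGroup W]
    [Module R W] (p : ι → R) (hp : Pairwise fun i j => IsCoprime (p i) (p j)) (M : ι → Type*)
    [∀ j, AddCommGroup (M j)] [∀ j, Module R (M j)] (hM : ∀ j (x : M j), p j • x = 0) :
    (∀ j, {φ : M j →ₗ[R] W // Function.Injective φ}) ≃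
      {φ : (∀ j, M j) →ₗ[R] W // Function.Injective φ} :=
  (Equiv.subtypePiEquivPi (p := fun j (φ : M j →ₗ[R] W) => Function.Injective φ)).symm.trans <|
    Equiv.subtypeEquiv (LinearMap.lsum R M R).toEquiv fun φ => by
      constructor
      · intro h
        rw [LinearEquiv.coe_toEquiv, ← LinearMap.ker_eq_bot, LinearMap.ker_eq_bot']
        intro x hx
        rw [LinearMap.lsum_apply, LinearMap.sum_apply] at hx
        simp only [LinearMap.comp_apply, LinearMap.proj_apply] at hx
        funext j
        refine h j ?_
        -- multiplication by the other `p i` isolates the `j`-th term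
        obtain ⟨u, v, huv⟩ : IsCoprime (p j) (∏ i ∈ Finset.univ.erase j, p i) :=
          IsCoprime.prod_right fun i hi => hp (Finset.ne_of_mem_erase hi).symm
        have h1 : (∏ i ∈ Finset.univ.erase j, p i) • φ j (x j) = 0 := by
          have h2 := congrArg (fun w => (∏ i ∈ Finset.univ.erase j, p i) • w) hx
          simp only [Finset.smul_sum, smul_zero] at h2
          rwa [Finset.sum_eq_single j] at h2
          · intro i _ hij
            rw [← Finset.prod_erase_mul _ _ (Finset.mem_erase.2 ⟨hij, Finset.mem_univ i⟩), mul_smul,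
              ← map_smul, hM, map_zero, smul_zero]
          · exact fun hj => absurd (Finset.mem_univ j) hj
        rw [Pi.zero_apply, map_zero, ← one_smul R (φ j (x j)), ← huv, add_smul, mul_smul, mul_smul,
          h1, ← map_smul, hM, map_zero, smul_zero, smul_zero, add_zero]
      · intro h j
        have : φ j = (LinearMap.lsum R M R φ).comp (LinearMap.single R M j) :=
          LinearMap.ext fun x => (LinearMap.lsum_piSingle R M R φ j x).symm
        rw [this]
        exact h.comp (Pi.single_injective j)

lemma card_injective_pi {R ι W : Type*} [CommRing R] [Fintype ι] [DecidableEq ι] [AddCommGroup W]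
    [Module R W] [Finite W] (p : ι → R) (hp : Pairwise fun i j => IsCoprime (p i) (p j))
    [∀ j, (Ideal.span {p j}).IsMaximal] [∀ j, Finite (R ⧸ Ideal.span {p j})] (m : ι → ℕ) :
    (Nat.card {φ : (∀ j, Fin (m j) → R ⧸ Ideal.span {p j}) →ₗ[R] W // Function.Injective φ} : ℝ) =
      ∏ j, ∏ i ∈ Finset.range (m j),
        ((Nat.card (R ⧸ Ideal.span {p j}) : ℝ) ^
          Module.finrank (R ⧸ Ideal.span {p j}) (Submodule.torsionBy R W (p j)) -
          (Nat.card (R ⧸ Ideal.span {p j}) : ℝ) ^ i) := by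
  have hz : ∀ j (x : Fin (m j) → R ⧸ Ideal.span {p j}), p j • x = 0 := by
    intro j x
    funext i
    obtain ⟨y, hy⟩ := Ideal.Quotient.mk_surjective (x i)
    rw [Pi.smul_apply, Pi.zero_apply, ← hy, ← Ideal.Quotient.mk_eq_mk, ← Submodule.Quotient.mk_smul,
      Ideal.Quotient.mk_eq_mk, Ideal.Quotient.eq_zero_iff_mem, smul_eq_mul]
    exact Ideal.mul_mem_right _ _ (Ideal.mem_span_singleton_self _)
  rw [← Nat.card_congr (injectiveLsumEquiv p hp _ hz), Nat.card_pi, Nat.cast_prod]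
  refine Finset.prod_congr rfl fun j _ => ?_
  let := Ideal.Quotient.field (Ideal.span {p j})
  rw [← card_injective_fin R (R ⧸ Ideal.span {p j}) (Submodule.torsionBy R W (p j))
    Ideal.Quotient.mk_surjective (m j)]
  congr 1
  refine Nat.card_congr
    { toFun := fun φ => ⟨φ.1.codRestrict _ fun x => ?_, ?_⟩
      invFun := fun φ => ⟨(Submodule.subtype _).comp φ.1, ?_⟩
      left_inv := fun _ => rfl
      right_inv := fun _ => rfl }
  · rw [Submodule.mem_torsionBy_iff, ← map_smul, hz, map_zero]
  · exact fun x y h => φ.2 (congrArg Subtype.val h)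
  · exact Subtype.val_injective.comp φ.2

/-- The maps of `F[X]`-modules from `M` to `V` with `X` acting through `a` are the `F`-linear maps
that intertwine `X` and `a`. -/
noncomputable def homAEvalEquiv {F M V : Type*} [CommRing F] [AddCommGroup M] [Module F M]
    [Module F[X] M] [IsScalarTower F F[X] M] [AddCommGroup V] [Module F V] (a : Module.End F V) :
    (M →ₗ[F[X]] Module.AEval' a) ≃
      {f : M →ₗ[F] V // a ∘ₗ f = f ∘ₗ ((LinearMap.lsmul F[X] M X).restrictScalars F)} where
  toFun φ := ⟨(Module.AEval'.of a).symm.toLinearMap ∘ₗ φ.restrictScalars F, by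
    ext x
    simp⟩
  invFun f :=
    { toFun := fun x => Module.AEval'.of a (f.1 x)
      map_add' := by simp
      map_smul' := fun s x => by
        have hX : ∀ y, f.1 ((X : F[X]) • y) = a (f.1 y) := fun y =>
          (LinearMap.congr_fun f.2 y).symm
        have hXn : ∀ (n : ℕ) y, f.1 ((X ^ n : F[X]) • y) = (a ^ n) (f.1 y) := by
          intro n
          induction n with
          | zero => simp
          | succ n ih => intro y; rw [pow_succ, mul_smul, ih, hX, pow_succ, Module.End.mul_apply]
        induction s using Polynomial.induction_on' with
        | add s t hs ht =>
          rw [RingHom.id_apply] at hs ht ⊢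
          rw [add_smul, map_add, map_add, hs, ht, add_smul]
        | monomial n c =>
          rw [RingHom.id_apply, ← smul_X_eq_monomial, smul_assoc, smul_assoc, map_smul, map_smul,
            hXn, Module.AEval'.X_pow_smul_of, Module.End.smul_def] }
  left_inv φ := by ext; simp
  right_inv f := by ext; simp

lemma card_fiber_mul_card {G H : Type*} [AddGroup G] [AddGroup H] [Finite G] (h : G →+ H)
    (hh : Function.Surjective h) (y : H) : Nat.card {x // h x = y} * Nat.card H = Nat.card G := by
  have := Finite.of_surjective h hh
  have := Fintype.ofFinite H
  have key : ∀ z, Nat.card {x // h x = z} = Nat.card {x // h x = y} := by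
    intro z
    obtain ⟨t, ht⟩ := hh (-z + y)
    exact Nat.card_congr (Equiv.subtypeEquiv (Equiv.addRight t) fun x => by
      rw [Equiv.coe_addRight, map_add, ht, ← add_assoc]
      constructor
      · rintro rfl; simp
      · intro h'
        rwa [add_eq_right, ← sub_eq_add_neg, sub_eq_zero] at h')
  rw [← Nat.card_congr (Equiv.sigmaFiberEquiv h), Nat.card_sigma, Finset.sum_congr rfl
    fun z _ => key z, Finset.sum_const, Finset.card_univ, smul_eq_mul, Nat.card_eq_fintype_card
    (α := H), mul_comm]

lemma card_injective_div_card (F M V : Type*) [Field F] [Finite F] [AddCommGroup M] [Module F M]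
    [Module.Finite F M] [AddCommGroup V] [Module F V] [Module.Finite F V] :
    (Nat.card {f : M →ₗ[F] V // Function.Injective f} : ℝ) / Nat.card (M →ₗ[F] V) =
      injProportion (Nat.card F) (Module.finrank F V) (Module.finrank F M) := by
  have : Finite V := Module.finite_of_finite F
  have e : M ≃ₗ[F] (Fin (Module.finrank F M) → F) := (Module.finBasis F M).equivFun
  have h1 : Nat.card {f : M →ₗ[F] V // Function.Injective f} =
      Nat.card {f : (Fin (Module.finrank F M) → F) →ₗ[F] V // Function.Injective f} :=
    Nat.card_congr (Equiv.subtypeEquiv (e.arrowCongr (LinearEquiv.refl F V)).toEquiv fun f => by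
      have : ⇑((e.arrowCongr (LinearEquiv.refl F V)) f) = f ∘ e.symm := rfl
      rw [LinearEquiv.coe_toEquiv, this]
      exact (e.symm.toEquiv.injective_comp f).symm)
  rw [h1, card_injective_fin F F V Function.surjective_id, injProportion, Finset.prod_div_distrib,
    Finset.prod_const, Finset.card_range, Module.natCard_eq_pow_finrank (K := F) (V := M →ₗ[F] V),
    Module.finrank_linearMap, Nat.cast_pow, ← pow_mul, mul_comm (Module.finrank F M)]

/-- The average, over all endomorphisms `a` of `V`, of the number of embeddings of an
`F[X]`-module `M` into `V` with `X` acting through `a`. An `F`-linear embedding `f : M → V` is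
`F[X]`-linear exactly for the `a` with a prescribed restriction to the range of `f`, hence for the
proportion `1 / |Hom(M, V)|` of all `a`. -/
lemma sum_card_injective (F M V : Type*) [Field F] [Finite F] [AddCommGroup M] [Module F M]
    [Module F[X] M] [IsScalarTower F F[X] M] [Module.Finite F M] [AddCommGroup V] [Module F V]
    [Module.Finite F V] [Fintype (Module.End F V)] :
    (∑ a : Module.End F V,
      (Nat.card {φ : M →ₗ[F[X]] Module.AEval' a // Function.Injective φ} : ℝ)) /
        Nat.card (Module.End F V) =
      injProportion (Nat.card F) (Module.finrank F V) (Module.finrank F M) := by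
  have : Finite (M →ₗ[F] V) := Module.finite_of_finite F
  have := Fintype.ofFinite {f : M →ₗ[F] V // Function.Injective f}
  set T : M →ₗ[F] M := (LinearMap.lsmul F[X] M X).restrictScalars F
  have h1 : ∀ a : Module.End F V,
      Nat.card {φ : M →ₗ[F[X]] Module.AEval' a // Function.Injective φ} =
        Nat.card {f : {f : M →ₗ[F] V // Function.Injective f} // a ∘ₗ f.1 = f.1 ∘ₗ T} := by
    intro a
    refine Nat.card_congr ((Equiv.subtypeEquiv (homAEvalEquiv a)
      (q := fun f => Function.Injective f.1) fun φ => ?_).trans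
      { toFun := fun f => ⟨⟨f.1.1, f.2⟩, f.1.2⟩
        invFun := fun f => ⟨⟨f.1.1, f.2⟩, f.1.2⟩
        left_inv := fun _ => rfl
        right_inv := fun _ => rfl })
    exact ((Module.AEval'.of a).symm.injective.of_comp_iff φ).symm
  have h2 : ∑ a : Module.End F V,
      Nat.card {f : {f : M →ₗ[F] V // Function.Injective f} // a ∘ₗ f.1 = f.1 ∘ₗ T} =
      ∑ f : {f : M →ₗ[F] V // Function.Injective f},
        Nat.card {a : Module.End F V // a ∘ₗ f.1 = f.1 ∘ₗ T} := by
    classical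
    simp only [Nat.card_eq_fintype_card, Fintype.card_subtype, Finset.card_filter]
    exact Finset.sum_comm
  have h3 : ∀ f : {f : M →ₗ[F] V // Function.Injective f},
      Nat.card {a : Module.End F V // a ∘ₗ f.1 = f.1 ∘ₗ T} * Nat.card (M →ₗ[F] V) =
        Nat.card (Module.End F V) := by
    intro f
    refine card_fiber_mul_card (LinearMap.lcomp F V f.1).toAddMonoidHom (fun g => ?_) _
    obtain ⟨s, hs⟩ := f.1.exists_leftInverse_of_injective (LinearMap.ker_eq_bot.2 f.2)
    exact ⟨g ∘ₗ s, by
      change (g ∘ₗ s) ∘ₗ f.1 = g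
      rw [LinearMap.comp_assoc, hs, LinearMap.comp_id]⟩
  have h4 : (∑ a : Module.End F V,
      Nat.card {φ : M →ₗ[F[X]] Module.AEval' a // Function.Injective φ}) * Nat.card (M →ₗ[F] V) =
      Nat.card {f : M →ₗ[F] V // Function.Injective f} * Nat.card (Module.End F V) := by
    rw [Finset.sum_congr rfl fun a _ => h1 a, h2, Finset.sum_mul, Finset.sum_congr rfl fun f _ =>
      h3 f, Finset.sum_const, Finset.card_univ, smul_eq_mul,
      Nat.card_eq_fintype_card (α := {f : M →ₗ[F] V // Function.Injective f})]
  have h5 : (Nat.card (M →ₗ[F] V) : ℝ) ≠ 0 := Nat.cast_ne_zero.2 Nat.card_pos.ne'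
  have h6 : (Nat.card (Module.End F V) : ℝ) ≠ 0 := Nat.cast_ne_zero.2 Nat.card_pos.ne'
  rw [← card_injective_div_card, div_eq_div_iff h6 h5]
  exact_mod_cast h4

/-! ### Invertibility of polynomials in an endomorphism -/

lemma isUnit_aeval_iff_finrank_torsionBy {F V : Type*} [Field F] [AddCommGroup V] [Module F V]
    [Module.Finite F V] (a : Module.End F V) (p : F[X]) [(Ideal.span {p}).IsMaximal]
    [Finite (Submodule.torsionBy F[X] (Module.AEval' a) p)] :
    Module.finrank (F[X] ⧸ Ideal.span {p}) (Submodule.torsionBy F[X] (Module.AEval' a) p) = 0 ↔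
      IsUnit (aeval a p) := by
  let := Ideal.Quotient.field (Ideal.span {p})
  have : Module.Finite (F[X] ⧸ Ideal.span {p})
    (Submodule.torsionBy F[X] (Module.AEval' a) p) := Module.Finite.of_finite
  rw [LinearMap.isUnit_iff_ker_eq_bot, LinearMap.ker_eq_bot']
  refine (Module.finrank_zero_iff (R := F[X] ⧸ Ideal.span {p})).trans ?_
  rw [Submodule.subsingleton_iff_eq_bot, Submodule.eq_bot_iff]
  constructor
  · intro h v hv
    have h1 := h (Module.AEval'.of a v) (by
      rw [Submodule.mem_torsionBy_iff, ← Module.AEval.of_aeval_smul, Module.End.smul_def, hv,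
        map_zero])
    simpa using h1
  · intro h x hx
    rw [Submodule.mem_torsionBy_iff] at hx
    have h1 := h ((Module.AEval'.of a).symm x) (by
      rw [← Module.End.smul_def, ← Module.AEval.of_symm_smul, hx, map_zero])
    simpa using h1

/-- The proportion of the endomorphisms `a` of `V` for which every `p j (a)` is invertible.
The `q`-binomial theorem expands the indicator function of this event into numbers of embeddings
of the semisimple modules `⨁ j, (F[X] / p j) ^ m j`, whose averages are known. -/
lemma card_forall_isUnit_aeval (F V : Type*) [Field F] [Finite F] [AddCommGroup V] [Module F V]
    [Module.Finite F V] {ι : Type*} [Fintype ι] [DecidableEq ι] (p : ι → F[X])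
    (hirr : ∀ j, Irreducible (p j)) (hp : Pairwise fun i j => IsCoprime (p i) (p j)) :
    (Nat.card {a : Module.End F V // ∀ j, IsUnit (aeval a (p j))} : ℝ) /
        Nat.card (Module.End F V) =
      ∑ m ∈ Fintype.piFinset fun _ : ι => Finset.range (Module.finrank F V + 1),
        (∏ j, eulerCoeff ((Nat.card F : ℝ) ^ (p j).natDegree) (m j)) *
          injProportion (Nat.card F) (Module.finrank F V) (∑ j, m j * (p j).natDegree) := by
  classical
  have : Finite V := Module.finite_of_finite F
  have : Finite (Module.End F V) := Module.finite_of_finite F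
  have := Fintype.ofFinite (Module.End F V)
  have hAE : ∀ a : Module.End F V, Finite (Module.AEval' a) := fun a => ‹Finite V›
  have hmax : ∀ j, (Ideal.span {p j}).IsMaximal := fun j =>
    PrincipalIdealRing.isMaximal_of_irreducible (hirr j)
  have hfin : ∀ j, Module.Finite F (F[X] ⧸ Ideal.span {p j}) := fun j =>
    Module.Finite.of_basis (AdjoinRoot.powerBasis (hirr j).ne_zero).basis
  have hfin' : ∀ j, Finite (F[X] ⧸ Ideal.span {p j}) := fun j => Module.finite_of_finite F
  have hcard : ∀ j, (Nat.card (F[X] ⧸ Ideal.span {p j})) = (Nat.card F) ^ (p j).natDegree :=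
    fun j => by rw [Module.natCard_eq_pow_finrank (K := F), finrank_quotient_span_eq_natDegree]
  have hq : 1 < Nat.card F := Finite.one_lt_card
  have hd : ∀ j, (p j).natDegree ≠ 0 := fun j => (hirr j).natDegree_pos.ne'
  have hQ : ∀ j, 1 < (Nat.card F : ℝ) ^ (p j).natDegree := fun j =>
    one_lt_pow₀ (by exact_mod_cast hq) (hd j)
  set k : Module.End F V → ι → ℕ := fun a j =>
    Module.finrank (F[X] ⧸ Ideal.span {p j}) (Submodule.torsionBy F[X] (Module.AEval' a) (p j))
    with hk
  have hkn : ∀ a j, k a j ≤ Module.finrank F V := by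
    intro a j
    let := Ideal.Quotient.field (Ideal.span {p j})
    have : Module.Finite (F[X] ⧸ Ideal.span {p j})
      (Submodule.torsionBy F[X] (Module.AEval' a) (p j)) := Module.Finite.of_finite
    refine (Nat.pow_le_pow_iff_right hq).1 ?_
    calc Nat.card F ^ k a j ≤ (Nat.card F ^ (p j).natDegree) ^ k a j :=
          Nat.pow_le_pow_left (Nat.le_self_pow (hd j) _) _
      _ = Nat.card (Submodule.torsionBy F[X] (Module.AEval' a) (p j)) := by
          rw [← hcard]
          exact (Module.natCard_eq_pow_finrank (K := F[X] ⧸ Ideal.span {p j})).symm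
      _ ≤ Nat.card (Module.AEval' a) := Nat.card_le_card_of_injective _ Subtype.val_injective
      _ = Nat.card F ^ Module.finrank F V :=
          (Module.natCard_eq_pow_finrank (K := F) (V := V))
  have h1 : (Nat.card {a : Module.End F V // ∀ j, IsUnit (aeval a (p j))} : ℝ) =
      ∑ a : Module.End F V, ∏ j, if k a j = 0 then (1 : ℝ) else 0 := by
    rw [Nat.card_eq_fintype_card, Fintype.card_subtype, Finset.card_filter, Nat.cast_sum]
    refine Finset.sum_congr rfl fun a _ => ?_
    have h : (∀ j ∈ Finset.univ, k a j = 0) ↔ ∀ j, IsUnit (aeval a (p j)) := by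
      simp only [Finset.mem_univ, true_imp_iff]
      exact forall_congr' fun j => isUnit_aeval_iff_finrank_torsionBy a (p j)
    rw [Finset.prod_ite_zero, Finset.prod_const_one]
    simp only [h, Nat.cast_ite, Nat.cast_one, Nat.cast_zero]
  have h2 : ∀ a : Module.End F V, (∏ j, if k a j = 0 then (1 : ℝ) else 0) =
      ∑ m ∈ Fintype.piFinset fun _ : ι => Finset.range (Module.finrank F V + 1),
        (∏ j, eulerCoeff ((Nat.card F : ℝ) ^ (p j).natDegree) (m j)) *
          Nat.card {φ : (∀ j, Fin (m j) → F[X] ⧸ Ideal.span {p j}) →ₗ[F[X]] Module.AEval' a //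
            Function.Injective φ} := by
    intro a
    rw [Finset.prod_congr rfl fun j _ => (sum_eulerCoeff_mul_eq_ite (hQ j) (hkn a j)).symm,
      Finset.prod_univ_sum]
    refine Finset.sum_congr rfl fun m _ => ?_
    rw [Finset.prod_mul_distrib, card_injective_pi p hp m]
    simp only [hcard, Nat.cast_pow, hk]
  rw [h1, Finset.sum_congr rfl fun a _ => h2 a, Finset.sum_comm, Finset.sum_div]
  refine Finset.sum_congr rfl fun m _ => ?_
  rw [← Finset.mul_sum, mul_div_assoc, sum_card_injective, Module.finrank_pi_fintype]
  simp only [Module.finrank_pi_fintype, Finset.sum_const, Finset.card_univ, Fintype.card_fin,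
    smul_eq_mul, finrank_quotient_span_eq_natDegree]

/-! ### Reduction from Haar measure to the residue field -/

/-- Over a local ring, surjectivity of `P(A)` can be tested modulo the maximal ideal, where it
means invertibility. -/
lemma mem_cokerVanishes_iff {R : Type*} [CommRing R] [IsLocalRing R] (P : R[X])
    (n : ℕ) (A : Matrix (Fin n) (Fin n) R) :
    A ∈ HaarMatrix.cokerVanishes P n ↔ IsUnit (aeval (A.map (residue R)) (P.map (residue R))) := by
  have h : aeval (A.map (residue R)) (P.map (residue R)) = (residue R).mapMatrix (aeval A P) := by
    refine (map_aeval_eq_aeval_map (φ := residue R) (ψ := (residue R).mapMatrix) ?_ P A).symm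
    ext x i j
    by_cases hij : i = j <;> simp [Matrix.algebraMap_matrix_apply, hij]
  rw [h, Matrix.isUnit_iff_isUnit_det, ← RingHom.map_det, isUnit_map_iff,
    ← Matrix.isUnit_iff_isUnit_det, ← Matrix.mulVec_surjective_iff_isUnit, HaarMatrix.cokerVanishes,
    Set.mem_ofPred_eq, Submodule.Quotient.subsingleton_iff, LinearMap.range_eq_top]
  rfl

section Haar

open HaarMatrix

variable {R : Type*} [CommRing R] [IsDomain R] [IsDiscreteValuationRing R]
    [IsAdicComplete (maximalIdeal R) R] [Finite (ResidueField R)]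

/-- The Haar measure of `Mat_n(R)` reduces to the uniform measure on matrices over the residue
field: the fibres of the reduction map are translates of each other. -/
lemma haarProb_preimage_residue (n : ℕ) (S : Set (Matrix (Fin n) (Fin n) (ResidueField R))) :
    haarProb R n {A | A.map (residue R) ∈ S} =
      (Nat.card S : ℝ) / Nat.card (Matrix (Fin n) (Fin n) (ResidueField R)) := by
  classical
  let : TopologicalSpace R := (maximalIdeal R).adicTopology
  let := matrixBorel R n
  have : BorelSpace (Matrix (Fin n) (Fin n) R) := ⟨rfl⟩
  have := matrix_isTopologicalAddGroup R n
  have := matrix_compactSpace R n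
  have := Fintype.ofFinite (Matrix (Fin n) (Fin n) (ResidueField R))
  change (matrixHaar R n).real _ = _
  have hinv : (matrixHaar R n).IsAddLeftInvariant := by
    unfold matrixHaar; infer_instance
  have hprob : IsProbabilityMeasure (matrixHaar R n) :=
    ⟨Measure.addHaarMeasure_self (K₀ := (⊤ : TopologicalSpace.PositiveCompacts _))⟩
  have hopen : ∀ c : ResidueField R, IsOpen {x : R | residue R x = c} := by
    intro c
    refine isOpen_iff_mem_nhds.2 fun x hx => ?_
    refine ((maximalIdeal R).hasBasis_nhds_adic x).mem_iff.2 ⟨1, trivial, ?_⟩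
    rintro _ ⟨y, hy, rfl⟩
    have hy' : residue R y = 0 := (IsLocalRing.residue_eq_zero_iff y).2 (by simpa using hy)
    change residue R (x + y) = c
    rw [map_add, hy', add_zero]
    exact hx
  have hfib : ∀ B : Matrix (Fin n) (Fin n) (ResidueField R),
      MeasurableSet {A : Matrix (Fin n) (Fin n) R | A.map (residue R) = B} := by
    intro B
    have : {A : Matrix (Fin n) (Fin n) R | A.map (residue R) = B} =
        ⋂ i, ⋂ j, {A | residue R (A i j) = B i j} := by
      ext A
      simp [← Matrix.ext_iff]
    rw [this]
    refine IsOpen.measurableSet (isOpen_iInter_of_finite fun i =>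
      isOpen_iInter_of_finite fun j => ?_)
    exact (hopen (B i j)).preimage (continuous_id.matrix_elem i j)
  have hconst : ∀ B : Matrix (Fin n) (Fin n) (ResidueField R),
      (matrixHaar R n).real {A | A.map (residue R) = B} =
        (matrixHaar R n).real {A | A.map (residue R) = 0} := by
    intro B
    obtain ⟨B, rfl⟩ : ∃ C : Matrix (Fin n) (Fin n) R, C.map (residue R) = B :=
      ⟨B.map (Function.surjInv IsLocalRing.residue_surjective), by
        ext i j
        simp [Function.surjInv_eq]⟩
    rw [Measure.real, ← measure_preimage_add (matrixHaar R n) B, ← Measure.real]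
    congr 1
    ext A
    simp [Matrix.map_add]
  have hsum : ∀ T : Set (Matrix (Fin n) (Fin n) (ResidueField R)),
      (matrixHaar R n).real {A | A.map (residue R) ∈ T} =
        Nat.card T * (matrixHaar R n).real {A | A.map (residue R) = 0} := by
    intro T
    have : {A : Matrix (Fin n) (Fin n) R | A.map (residue R) ∈ T} =
        ⋃ B ∈ T.toFinset, {A | A.map (residue R) = B} := by
      ext A
      simp
    rw [this, measureReal_biUnion_finset _ fun B _ => hfib B, Finset.sum_congr rfl fun B _ =>
      hconst B, Finset.sum_const, nsmul_eq_mul, Set.toFinset_card, Nat.card_eq_fintype_card]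
    intro B _ C _ hBC
    exact Set.disjoint_left.2 fun A hA hA' => hBC (hA.symm.trans hA')
  have huniv := hsum Set.univ
  simp only [Set.mem_univ, Set.ofPred_true, probReal_univ, Nat.card_univ] at huniv
  rw [hsum, eq_div_iff (Nat.cast_ne_zero.2 Nat.card_pos.ne'), mul_assoc,
    mul_comm (Measure.real _ _), ← huniv, mul_one]

lemma haarProb_iInter_cokerVanishes {ι : Type*} [Fintype ι] [DecidableEq ι] (P : ι → R[X])
    (hmonic : ∀ j, (P j).Monic) (hirr : ∀ j, Irreducible ((P j).map (residue R)))
    (hdist : ∀ i j, i ≠ j → (P i).map (residue R) ≠ (P j).map (residue R)) (n : ℕ) :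
    haarProb R n (⋂ j, cokerVanishes (P j) n) =
      ∑ m ∈ Fintype.piFinset fun _ : ι => Finset.range (n + 1),
        (∏ j, eulerCoeff ((Nat.card (ResidueField R) : ℝ) ^ (P j).natDegree) (m j)) *
          injProportion (Nat.card (ResidueField R)) n (∑ j, m j * (P j).natDegree) := by
  have hcop : Pairwise fun i j => IsCoprime ((P i).map (residue R)) ((P j).map (residue R)) := by
    intro i j hij
    refine ((hirr i).coprime_iff_not_dvd).2 fun hdvd => hdist i j hij ?_
    exact eq_of_monic_of_associated ((hmonic i).map _) ((hmonic j).map _)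
      ((hirr i).associated_of_dvd (hirr j) hdvd)
  have h1 := card_forall_isUnit_aeval (ResidueField R) (Fin n → ResidueField R)
    (fun j => (P j).map (residue R)) hirr hcop
  simp only [Module.finrank_fin_fun, (hmonic _).natDegree_map] at h1
  rw [← h1]
  have h2 : (⋂ j, cokerVanishes (P j) n) = {A : Matrix (Fin n) (Fin n) R | A.map (residue R) ∈
      {B | ∀ j, IsUnit (aeval B ((P j).map (residue R)))}} := by
    ext A
    simp [mem_cokerVanishes_iff]
  rw [h2, haarProb_preimage_residue]
  congr 2
  · refine Nat.card_congr (Equiv.subtypeEquiv Matrix.toLinAlgEquiv'.toEquiv fun B => ?_)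
    refine forall_congr' fun j => ?_
    change _ ↔ IsUnit (aeval (Matrix.toLinAlgEquiv' B) _)
    rw [aeval_algHom_apply]
    exact (MulEquiv.isUnit_map Matrix.toLinAlgEquiv').symm
  · exact Nat.card_congr Matrix.toLinAlgEquiv'.toEquiv

/-- The limiting joint probability, for an arbitrary finite family, so that it applies to
subfamilies and to single polynomials as well. -/
lemma tendsto_haarProb_iInter_cokerVanishes {ι : Type*} [Fintype ι] (P : ι → R[X])
    (hmonic : ∀ j, (P j).Monic) (hirr : ∀ j, Irreducible ((P j).map (residue R)))
    (hdist : ∀ i j, i ≠ j → (P i).map (residue R) ≠ (P j).map (residue R)) :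
    Tendsto (fun n : ℕ => haarProb R n (⋂ j, cokerVanishes (P j) n)) atTop
      (𝓝 (∏ j, ∏' i : ℕ,
        (1 - ((Nat.card (ResidueField R) : ℝ) ^ ((i + 1) * (P j).natDegree))⁻¹))) := by
  classical
  have hq : (1 : ℝ) < Nat.card (ResidueField R) := by exact_mod_cast Finite.one_lt_card
  have hd : ∀ j, 0 < (P j).natDegree := fun j =>
    (hmonic j).natDegree_map (residue R) ▸ (hirr j).natDegree_pos
  have hQ : ∀ j, 1 < (Nat.card (ResidueField R) : ℝ) ^ (P j).natDegree := fun j =>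
    one_lt_pow₀ hq (hd j).ne'
  simp_rw [haarProb_iInter_cokerVanishes P hmonic hirr hdist, mul_comm (_ + 1), pow_mul,
    ← tsum_eulerCoeff (hQ _)]
  exact tendsto_sum_mul_injProportion _ (fun j => summable_abs_eulerCoeff (hQ j)) hq _ hd

end Haar

theorem theoremB {R : Type*} [CommRing R] [IsDomain R] [IsDiscreteValuationRing R]
    [IsAdicComplete (maximalIdeal R) R] [Finite (ResidueField R)]
    (q : ℕ) (hq : q = Nat.card (ResidueField R))
    (r : ℕ) (P : Fin r → R[X]) (hmonic : ∀ j, (P j).Monic)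
    (hirr : ∀ j, Irreducible ((P j).map (residue R)))
    (hdist : ∀ i j, i ≠ j → (P i).map (residue R) ≠ (P j).map (residue R)) :
    -- the infinite products converge
    (∀ j, Multipliable fun i : ℕ => 1 - ((q : ℝ) ^ ((i + 1) * (P j).natDegree))⁻¹) ∧
    -- the limit of the joint probability
    Tendsto (fun n : ℕ => HaarMatrix.haarProb R n (⋂ j, HaarMatrix.cokerVanishes (P j) n)) atTop
      (𝓝 (∏ j, ∏' i : ℕ, (1 - ((q : ℝ) ^ ((i + 1) * (P j).natDegree))⁻¹))) ∧
    -- asymptotic (mutual) independence of the vanishing events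
    (∀ S : Finset (Fin r), Tendsto (fun n : ℕ =>
        HaarMatrix.haarProb R n (⋂ j ∈ S, HaarMatrix.cokerVanishes (P j) n) -
          ∏ j ∈ S, HaarMatrix.haarProb R n (HaarMatrix.cokerVanishes (P j) n)) atTop (𝓝 0)) := by
  subst hq
  refine ⟨fun j => ?_, tendsto_haarProb_iInter_cokerVanishes P hmonic hirr hdist, fun S => ?_⟩
  · have hd : 0 < (P j).natDegree := (hmonic j).natDegree_map (residue R) ▸ (hirr j).natDegree_pos
    simp_rw [mul_comm (_ + 1), pow_mul]
    refine multipliable_one_sub_inv_pow (one_lt_pow₀ ?_ hd.ne')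
    exact_mod_cast Finite.one_lt_card
  · have h1 := tendsto_haarProb_iInter_cokerVanishes (fun j : S => P j) (fun j => hmonic j)
      (fun j => hirr j) fun i j hij => hdist i j (Subtype.coe_injective.ne hij)
    have h2 : ∀ j ∈ S, _ := fun j _ => tendsto_haarProb_iInter_cokerVanishes (fun _ : Unit => P j)
      (fun _ => hmonic j) (fun _ => hirr j) fun _ _ h => absurd rfl h
    have h3 := h1.sub (tendsto_finsetProd S h2)
    simp only [Finset.univ_unique, Finset.prod_singleton, Set.iInter_const,
      Finset.prod_coe_sort S fun j => ∏' i : ℕ,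
        (1 - ((Nat.card (ResidueField R) : ℝ) ^ ((i + 1) * (P j).natDegree))⁻¹), sub_self] at h3
    simpa only [Set.iInter_subtype] using h3
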